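/- Let $\mathbb{k}$ be a commutative unital ring, $A$ an associative unital $\mathbb{k}$-algebra, and $\Omega_d^\bullet$ an exterior algebra over $A$: a graded associative $\mathbb{k}$-algebra with $\Omega_d^0=A$, product $\wedge$, and a $\mathbb{k}$-linear differential $d$ of degree $1$ with $d^2=0$ and the graded Leibniz rule, generated as an algebra by $A$ and $dA$. For a left $A$-module $E$, let $J_d^1E=J_d^1A\otimes_A E$, where $J^1_dA$ is the quotient of $A\otimes A$ by the kernel of $\sum a_i\otimes b_i\mapsto(\sum a_ib_i,\sum (da_i)b_i)\in A\times\Omega^1_d$, with prolongation $j^1_d(e)=[1\otimes 1]\otimes e$. The holonomic jet modules are $J_d^0E=E$ (with $j_d^0=\mathrm{id}_E$), $J_d^1E$, and, for $n\ge 2$, the submodule $J_d^nE\subseteq J_d^1J_d^{n-1}E$ of the elements that $J_d^1(l^{n-1})$ sends into the joint kernel of the maps $[a\otimes b]\otimes[c\otimes e]\mapsto a\,d(bc)\otimes e\in\Omega_d^1\otimes_AJ_d^{n-2}E$ and $[a\otimes b]\otimes[c\otimes e]\mapsto da\wedge d(bc)\otimes e\in\Omega_d^2\otimes_AJ_d^{n-2}E$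 on $J^1_dJ^1_dJ_d^{n-2}E$. Here $l^{n-1}\colon J_d^{n-1}E\to J_d^1J_d^{n-2}E$ is the inclusion (the identity for $n=2$); $j_d^n\colon E\to J_d^nE$ is $j_d^1\circ j_d^{n-1}$. For left $A$-modules $E,F$ let $\mathrm{Diff}_d^n(E,F)$ be the set of $\mathbb{k}$-linear maps $\Delta\colon E\to F$ such that $\Delta=\widetilde\Delta\circ j_d^n$ for some $A$-linear $\widetilde\Delta\colon J_d^nE\to F$. Put $\mathrm{Diff}_d^{-1}(E,F)=0$, $\mathrm{Diff}_d(E,F)=\bigcup_n\mathrm{Diff}_d^n(E,F)$, $\mathrm{Symb}_d^n(E,F)=\mathrm{Diff}_d^n(E,F)/\mathrm{Diff}_d^{n-1}(E,F)$ with quotient map $\varsigma_d^n$, and $\mathrm{Symb}_d^\bullet(E,F)=\bigoplus_{n\in\mathbb{N}}\mathrm{Symb}_d^n(E,F)$. The ring ${}_A\mathrm{Hom}(F,F)$ acts on all of these by composition. A full quantization for $(E,F)$ is a map $q=\sum_nq^n\colon\mathrm{Symb}_d^\bullet(E,F)\to\mathrm{Diff}_d(E,F)$ where each $q^n\colon\mathrm{Symb}_d^n(E,F)\to\mathrm{Diff}_d^n(E,F)$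 is ${}_A\mathrm{Hom}(F,F)$-linear and $\varsigma_d^n\circ q^n=\mathrm{id}$. A natural full quantization for $E$ is a map $q=\sum_nq^n$ where each $q^n\colon\mathrm{Symb}_d^n(E,-)\to\mathrm{Diff}_d^n(E,-)$ is a natural transformation of functors from left $A$-modules to $\mathbb{k}$-modules with $\varsigma_d^n\circ q^n=\mathrm{id}$; its component at each $F$ is a full quantization for $(E,F)$. Given a full quantization $q$ for $(E,F)$ and $\Delta\in\mathrm{Diff}_d(E,F)$ of order $n$, the truncations of $\Delta$ are $\Delta_k:=\Delta$ for $k\ge n$ and, recursively, $\Delta_k:=\Delta_{k+1}-q^{k+1}(\varsigma_d^{k+1}(\Delta_{k+1}))\in\mathrm{Diff}_d^k(E,F)$ for $0\le k<n$. Put $[\Delta]_q^k:=\varsigma_d^k(\Delta_k)$; it vanishes for $k>n$. The total symbol of $\Delta$ is $\varsigma_q(\Delta):=\sum_{k\in\mathbb{N}}[\Delta]_q^k\in\mathrm{Symb}_d^\bullet(E,F)$. **Proposition 5.24.** Let $E$ be a left $A$-module. 1. For every left $A$-module $F$, every full quantization $q$ for $(E,F)$ is invertible with inverse $\varsigma_q$,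 and this gives an ${}_A\mathrm{Hom}(F,F)$-linear isomorphism $\mathrm{Diff}_d(E,F)\cong\mathrm{Symb}_d^\bullet(E,F)$. Moreover, every $\Delta\in\mathrm{Diff}_d(E,F)$ is the sum of its homogeneous components: $\Delta=\sum_{k\in\mathbb{N}}q^k([\Delta]_q^k)$, where only finitely many terms are nonzero. 2. Every natural full quantization $q$ for $E$ is a natural isomorphism $\mathrm{Symb}_d^\bullet(E,-)\cong\mathrm{Diff}_d(E,-)$ of functors from left $A$-modules to $\mathbb{k}$-modules, whose inverse has the component $\varsigma_{q_F}$ at each $F$. -/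

import Mathlib

open scoped TensorProduct DirectSum
open CategoryTheory

universe u w

noncomputable section

namespace NCJet

/-! ### Exterior algebras over a noncommutative algebra -/

/-- An exterior algebra `Ω_d^•` over an associative unital `k`-algebra `A`: a graded associative
`k`-algebra with `Ω^0 = A`, a `k`-linear differential `d` of degree one with `d ∘ d = 0` that
satisfies the graded Leibniz rule, such that `Ω` is generated as an algebra by `A` and `dA`.
The product of `Ω` is the wedge product. -/
structure ExteriorCalculus (k : Type w) [CommRing k] (A : Type u) [Ring A] [Algebra k A] where
  /-- the total space of forms -/
  Ω : Type u
  [ring : Ring Ω]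
  [algebra : Algebra k Ω]
  /-- the homogeneous components -/
  deg : ℕ → Submodule k Ω
  [graded : GradedAlgebra deg]
  /-- the identification of `A` with the forms of degree zero -/
  ι : A →ₐ[k] Ω
  ι_injective : Function.Injective ι
  range_ι : LinearMap.range ι.toLinearMap = deg 0
  /-- the exterior derivative -/
  d : Ω →ₗ[k] Ω
  d_mem : ∀ (n : ℕ) (ω : Ω), ω ∈ deg n → d ω ∈ deg (n + 1)
  d_d : ∀ ω : Ω, d (d ω) = 0
  leibniz : ∀ (n : ℕ) (ω η : Ω), ω ∈ deg n → d (ω * η) = d ω * η + (-1) ^ n * (ω * d η)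
  generated : Algebra.adjoin k (Set.range ι ∪ Set.range (fun a => d (ι a))) = ⊤

attribute [instance] ExteriorCalculus.ring ExteriorCalculus.algebra ExteriorCalculus.graded

variable {k : Type w} [CommRing k] {A : Type u} [Ring A] [Algebra k A]
variable (X : ExteriorCalculus k A)

namespace ExteriorCalculus

/-- The `A`-bimodule `Ω_d^m` of forms of degree `m`. -/
def Form (m : ℕ) : Type u := X.deg m

instance (m : ℕ) : AddCommGroup (X.Form m) := inferInstanceAs (AddCommGroup (X.deg m))

variable {X}

lemma ι_mem (a : A) : X.ι a ∈ X.deg 0 := by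
  rw [← X.range_ι]
  exact ⟨a, rfl⟩

lemma mul_mem' {m n l : ℕ} (h : m + n = l) {ω η : X.Ω} (hω : ω ∈ X.deg m) (hη : η ∈ X.deg n) :
    ω * η ∈ X.deg l := h ▸ SetLike.mul_mem_graded hω hη

/-- The wedge product of homogeneous forms. -/
def Form.wedge {m n l : ℕ} (h : m + n = l) (ω : X.Form m) (η : X.Form n) : X.Form l :=
  ⟨ω.1 * η.1, mul_mem' h ω.2 η.2⟩

/-- The exterior derivative on forms of degree `m`. -/
def Form.diff {m : ℕ} (ω : X.Form m) : X.Form (m + 1) := ⟨X.d ω.1, X.d_mem m _ ω.2⟩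

/-- An element of `A` as a form of degree zero. -/
def Form.ofAlg (X : ExteriorCalculus k A) (a : A) : X.Form 0 := ⟨X.ι a, ι_mem a⟩

/-- The differential `da` of `a : A`. -/
def dA (X : ExteriorCalculus k A) (a : A) : X.Form 1 := (Form.ofAlg X a).diff

/-- The left action of `A` on forms is left multiplication. -/
instance (m : ℕ) : Module A (X.Form m) where
  smul a ω := (Form.ofAlg X a).wedge (zero_add m) ω
  one_smul ω := Subtype.ext (by change X.ι 1 * ω.1 = ω.1; simp)
  mul_smul a b ω := Subtype.ext (by
    change X.ι (a * b) * ω.1 = X.ι a * (X.ι b * ω.1); simp [mul_assoc])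
  smul_zero a := Subtype.ext (by change X.ι a * 0 = 0; simp)
  smul_add a ω η := Subtype.ext (by
    change X.ι a * (ω.1 + η.1) = X.ι a * ω.1 + X.ι a * η.1; exact mul_add _ _ _)
  add_smul a b ω := Subtype.ext (by
    change X.ι (a + b) * ω.1 = X.ι a * ω.1 + X.ι b * ω.1; simp [add_mul])
  zero_smul ω := Subtype.ext (by change X.ι 0 * ω.1 = 0; simp)

/-- The right action of `A` on forms. -/
def Form.rmul {m : ℕ} (ω : X.Form m) (a : A) : X.Form m :=
  ω.wedge (add_zero m) (Form.ofAlg X a)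

@[ext] lemma Form.ext {m : ℕ} {ω η : X.Form m} (h : ω.1 = η.1) : ω = η := Subtype.ext h

@[simp] lemma Form.val_add {m : ℕ} (ω η : X.Form m) : (ω + η).1 = ω.1 + η.1 := rfl
@[simp] lemma Form.val_neg {m : ℕ} (ω : X.Form m) : (-ω).1 = -ω.1 := rfl
@[simp] lemma Form.val_sub {m : ℕ} (ω η : X.Form m) : (ω - η).1 = ω.1 - η.1 := rfl
@[simp] lemma Form.val_zero {m : ℕ} : (0 : X.Form m).1 = 0 := rfl
@[simp] lemma Form.val_smul {m : ℕ} (a : A) (ω : X.Form m) : (a • ω).1 = X.ι a * ω.1 := rfl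
@[simp] lemma Form.val_rmul {m : ℕ} (ω : X.Form m) (a : A) : (ω.rmul a).1 = ω.1 * X.ι a := rfl
@[simp] lemma Form.val_wedge {m n l : ℕ} (h : m + n = l) (ω : X.Form m) (η : X.Form n) :
    (ω.wedge h η).1 = ω.1 * η.1 := rfl
@[simp] lemma Form.val_diff {m : ℕ} (ω : X.Form m) : (ω.diff).1 = X.d ω.1 := rfl
@[simp] lemma val_dA (a : A) : (X.dA a).1 = X.d (X.ι a) := rfl

lemma d_ι_mul (a : A) (ω : X.Ω) : X.d (X.ι a * ω) = X.d (X.ι a) * ω + X.ι a * X.d ω := by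
  simpa using X.leibniz 0 (X.ι a) ω (ι_mem a)

lemma d_mul_ι (ω : X.Form 1) (a : A) :
    X.d (ω.1 * X.ι a) = X.d ω.1 * X.ι a - ω.1 * X.d (X.ι a) := by
  rw [X.leibniz 1 ω.1 (X.ι a) ω.2]
  simp [sub_eq_add_neg]

lemma dA_one : X.dA 1 = 0 := by
  have h := d_ι_mul (X := X) 1 1
  ext
  simpa using h

lemma dA_mul (a b : A) : X.dA (a * b) = (X.dA a).rmul b + a • X.dA b := by
  ext
  simp [d_ι_mul]

lemma dA_add (a b : A) : X.dA (a + b) = X.dA a + X.dA b := by ext; simp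

lemma dA_zero : X.dA 0 = 0 := by ext; simp

end ExteriorCalculus

open ExteriorCalculus

/-! ### The balanced tensor product `Ω_d^m ⊗_A P` -/

section Tens

variable (m : ℕ) (P : Type u) [AddCommGroup P] [Module A P]

/-- The relations `ωa ⊗ p = ω ⊗ ap` that turn the tensor product over `ℤ` into the one over `A`. -/
def tensRel : Submodule A (X.Form m ⊗[ℤ] P) :=
  Submodule.span A {t | ∃ (ω : X.Form m) (a : A) (p : P), t = ω.rmul a ⊗ₜ[ℤ] p - ω ⊗ₜ[ℤ] (a • p)}

/-- The left `A`-module `Ω_d^m ⊗_A P`, for a left `A`-module `P`. -/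
def Tens : Type u := (X.Form m ⊗[ℤ] P) ⧸ tensRel X m P

instance : AddCommGroup (Tens X m P) :=
  inferInstanceAs (AddCommGroup ((X.Form m ⊗[ℤ] P) ⧸ tensRel X m P))

instance : Module A (Tens X m P) :=
  inferInstanceAs (Module A ((X.Form m ⊗[ℤ] P) ⧸ tensRel X m P))

variable {m P}

/-- The pure tensor `ω ⊗_A p`. -/
def Tens.mk (ω : X.Form m) (p : P) : Tens X m P := (tensRel X m P).mkQ (ω ⊗ₜ[ℤ] p)

variable {X}

lemma Tens.mk_add (ω : X.Form m) (p q : P) : mk X ω (p + q) = mk X ω p + mk X ω q := by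
  simp only [mk, TensorProduct.tmul_add, map_add]; rfl

lemma Tens.add_mk (ω η : X.Form m) (p : P) : mk X (ω + η) p = mk X ω p + mk X η p := by
  simp only [mk, TensorProduct.add_tmul, map_add]; rfl

lemma Tens.mk_zero (ω : X.Form m) : mk X ω (0 : P) = 0 := by
  simp only [mk, TensorProduct.tmul_zero, map_zero]; rfl

lemma Tens.zero_mk (p : P) : mk X (0 : X.Form m) p = 0 := by
  simp only [mk, TensorProduct.zero_tmul, map_zero]; rfl

lemma Tens.smul_mk (a : A) (ω : X.Form m) (p : P) : a • mk X ω p = mk X (a • ω) p := rfl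

lemma Tens.rmul_mk (ω : X.Form m) (a : A) (p : P) : mk X (ω.rmul a) p = mk X ω (a • p) := by
  refine (Submodule.Quotient.eq (tensRel X m P)).2 (Submodule.subset_span ?_)
  exact ⟨ω, a, p, rfl⟩

lemma Tens.induction {motive : Tens X m P → Prop} (zero : motive 0)
    (mk : ∀ ω p, motive (Tens.mk X ω p)) (add : ∀ s t, motive s → motive t → motive (s + t))
    (t : Tens X m P) : motive t := by
  obtain ⟨t, rfl⟩ := Submodule.Quotient.mk_surjective (tensRel X m P) t
  induction t using TensorProduct.induction_on with
  | zero => exact zero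
  | tmul ω p => exact mk ω p
  | add s t hs ht => exact add _ _ hs ht

/-- The universal property of `Ω_d^m ⊗_A P`: a biadditive balanced map induces an additive map. -/
def Tens.lift {G : Type u} [AddCommGroup G] (f : X.Form m →+ P →+ G)
    (hf : ∀ ω a p, f (ω.rmul a) p = f ω (a • p)) : Tens X m P →+ G :=
  QuotientAddGroup.lift (tensRel X m P).toAddSubgroup
    (TensorProduct.liftAddHom f (fun r ω p => by simp)) (by
      intro t ht
      replace ht : t ∈ tensRel X m P := ht
      rw [AddMonoidHom.mem_ker]
      induction ht using Submodule.closure_induction with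
      | zero => simp
      | add s t _ _ hs ht => rw [map_add, hs, ht, add_zero]
      | smul_mem b t hb =>
        obtain ⟨ω, a, p, rfl⟩ := hb
        have h := hf (b • ω) a p
        have e : (b • ω).rmul a = b • ω.rmul a := by ext; simp [mul_assoc]
        rw [e] at h
        rw [smul_sub, TensorProduct.smul_tmul', TensorProduct.smul_tmul', map_sub]
        simpa [sub_eq_zero] using h)

@[simp] lemma Tens.lift_mk {G : Type u} [AddCommGroup G] (f : X.Form m →+ P →+ G)
    (hf : ∀ ω a p, f (ω.rmul a) p = f ω (a • p)) (ω : X.Form m) (p : P) :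
    Tens.lift f hf (Tens.mk X ω p) = f ω p := rfl

/-- The tensor product as a biadditive map. -/
def Tens.mkHom (X : ExteriorCalculus k A) (m : ℕ) (P : Type u) [AddCommGroup P] [Module A P] :
    X.Form m →+ P →+ Tens X m P :=
  AddMonoidHom.mk' (fun ω => AddMonoidHom.mk' (fun p => Tens.mk X ω p) (Tens.mk_add ω))
    (fun ω η => by ext p; exact Tens.add_mk ω η p)

@[simp] lemma Tens.mkHom_apply (ω : X.Form m) (p : P) : Tens.mkHom X m P ω p = Tens.mk X ω p := rfl

/-- Functoriality: `id ⊗_A f : Ω_d^m ⊗_A P → Ω_d^m ⊗_A Q` for an `A`-linear map `f : P → Q`. -/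
def Tens.map {Q : Type u} [AddCommGroup Q] [Module A Q] (f : P →ₗ[A] Q) :
    Tens X m P →ₗ[A] Tens X m Q where
  toFun := Tens.lift ((AddMonoidHom.compHom' f.toAddMonoidHom).comp (Tens.mkHom X m Q))
    (fun ω a p => by simp [Tens.rmul_mk])
  map_add' := map_add _
  map_smul' a t := by
    induction t using Tens.induction with
    | zero => simp
    | mk ω p => simp [Tens.smul_mk]
    | add s t hs ht => rw [smul_add, map_add, hs, ht, map_add, smul_add]

@[simp] lemma Tens.map_mk {Q : Type u} [AddCommGroup Q] [Module A Q] (f : P →ₗ[A] Q)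
    (ω : X.Form m) (p : P) : Tens.map f (Tens.mk X ω p) = Tens.mk X ω (f p) := rfl

/-- Left wedge multiplication by `ω`, as a map `Ω_d^n ⊗_A P → Ω_d^{m+n} ⊗_A P`. -/
def Tens.wedge {n l : ℕ} (h : m + n = l) (ω : X.Form m) : Tens X n P →+ Tens X l P :=
  Tens.lift (AddMonoidHom.mk' (fun η => Tens.mkHom X l P (ω.wedge h η))
      (fun η θ => by rw [← map_add]; congr 1; ext; simp [mul_add]))
    (fun η a p => by
      have : ω.wedge h (η.rmul a) = (ω.wedge h η).rmul a := by ext; simp [mul_assoc]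
      simp [this, Tens.rmul_mk])

@[simp] lemma Tens.wedge_mk {n l : ℕ} (h : m + n = l) (ω : X.Form m) (η : X.Form n) (p : P) :
    Tens.wedge h ω (Tens.mk X η p) = Tens.mk X (ω.wedge h η) p := by
  simp [Tens.wedge]

lemma Tens.wedge_add {n l : ℕ} (h : m + n = l) (ω η : X.Form m) (t : Tens X n P) :
    Tens.wedge h (ω + η) t = Tens.wedge h ω t + Tens.wedge h η t := by
  induction t using Tens.induction with
  | zero => simp
  | mk θ p =>
    have : (ω + η).wedge h θ = ω.wedge h θ + η.wedge h θ := by ext; simp [add_mul]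
    simp [this, Tens.add_mk]
  | add s t hs ht => simp only [map_add, hs, ht]; abel

lemma Tens.wedge_rmul {n l : ℕ} (h : m + n = l) (ω : X.Form m) (a : A) (t : Tens X n P) :
    Tens.wedge h (ω.rmul a) t = Tens.wedge h ω (a • t) := by
  induction t using Tens.induction with
  | zero => simp
  | mk θ p =>
    have : (ω.rmul a).wedge h θ = ω.wedge h (a • θ) := by ext; simp [mul_assoc]
    simp [this, Tens.smul_mk]
  | add s t hs ht => simp only [map_add, smul_add, hs, ht]

lemma Tens.wedge_smul {n l : ℕ} (h : m + n = l) (ω : X.Form m) (a : A) (t : Tens X n P) :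
    Tens.wedge h (a • ω) t = a • Tens.wedge h ω t := by
  induction t using Tens.induction with
  | zero => simp
  | mk θ p =>
    have : (a • ω).wedge h θ = a • ω.wedge h θ := by ext; simp [mul_assoc]
    simp [this, Tens.smul_mk]
  | add s t hs ht => simp only [map_add, smul_add, hs, ht]

end Tens

/-! ### The 1-jet functor

`J_d^1 P = J_d^1 A ⊗_A P`, where `J_d^1 A` is the quotient of `A ⊗ A` by the kernel of the map
`∑ a_i ⊗ b_i ↦ (∑ a_i b_i, ∑ (da_i) b_i)`.  The class `[a ⊗ b] ⊗ p` corresponds to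
the pair `(abp, -(da) b ⊗ p)`, that is to its image under the two splittings `π^{1,0}` and `ρ` of
the `1`-jet sequence; this identifies `J_d^1 P` with `P × (Ω_d^1 ⊗_A P)` as an abelian group, with
the `A`-module structure `a (p, η) = (ap, aη - da ⊗ p)`. -/

section Jet

/-- The 1-jet module `J_d^1 P`. -/
@[ext] structure J1 (P : Type u) [AddCommGroup P] [Module A P] : Type u where
  /-- the 1-jet projection `π^{1,0} : J_d^1 P → P` -/
  pr : P
  /-- the `k`-linear splitting `ρ : J_d^1 P → Ω_d^1 ⊗_A P` -/
  rho : Tens X 1 P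

variable {X}
variable {P : Type u} [AddCommGroup P] [Module A P]

namespace J1

instance : Zero (J1 X P) := ⟨⟨0, 0⟩⟩
instance : Add (J1 X P) := ⟨fun ξ ζ => ⟨ξ.pr + ζ.pr, ξ.rho + ζ.rho⟩⟩
instance : Neg (J1 X P) := ⟨fun ξ => ⟨-ξ.pr, -ξ.rho⟩⟩
instance : Sub (J1 X P) := ⟨fun ξ ζ => ⟨ξ.pr - ζ.pr, ξ.rho - ζ.rho⟩⟩
instance : SMul A (J1 X P) := ⟨fun a ξ => ⟨a • ξ.pr, a • ξ.rho - Tens.mk X (X.dA a) ξ.pr⟩⟩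

@[simp] lemma zero_pr : (0 : J1 X P).pr = 0 := rfl
@[simp] lemma zero_rho : (0 : J1 X P).rho = 0 := rfl
@[simp] lemma add_pr (ξ ζ : J1 X P) : (ξ + ζ).pr = ξ.pr + ζ.pr := rfl
@[simp] lemma add_rho (ξ ζ : J1 X P) : (ξ + ζ).rho = ξ.rho + ζ.rho := rfl
@[simp] lemma neg_pr (ξ : J1 X P) : (-ξ).pr = -ξ.pr := rfl
@[simp] lemma neg_rho (ξ : J1 X P) : (-ξ).rho = -ξ.rho := rfl
@[simp] lemma sub_pr (ξ ζ : J1 X P) : (ξ - ζ).pr = ξ.pr - ζ.pr := rfl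
@[simp] lemma sub_rho (ξ ζ : J1 X P) : (ξ - ζ).rho = ξ.rho - ζ.rho := rfl
@[simp] lemma smul_pr (a : A) (ξ : J1 X P) : (a • ξ).pr = a • ξ.pr := rfl
@[simp] lemma smul_rho (a : A) (ξ : J1 X P) :
    (a • ξ).rho = a • ξ.rho - Tens.mk X (X.dA a) ξ.pr := rfl

instance : AddCommGroup (J1 X P) where
  add_assoc ξ ζ θ := by ext <;> simp [add_assoc]
  zero_add ξ := by ext <;> simp
  add_zero ξ := by ext <;> simp
  nsmul := nsmulRec
  zsmul := zsmulRec
  neg_add_cancel ξ := by ext <;> simp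
  add_comm ξ ζ := by ext <;> simp [add_comm]
  sub_eq_add_neg ξ ζ := by ext <;> simp [sub_eq_add_neg]

instance : Module A (J1 X P) where
  one_smul ξ := by ext <;> simp [dA_one, Tens.zero_mk]
  mul_smul a b ξ := by
    ext
    · simp [mul_smul]
    · simp [mul_smul, dA_mul, Tens.add_mk, Tens.rmul_mk, Tens.smul_mk, smul_sub]; abel
  smul_zero a := by ext <;> simp [Tens.mk_zero]
  smul_add a ξ ζ := by
    ext
    · simp
    · simp [Tens.mk_add]; abel
  add_smul a b ξ := by
    ext
    · simp [add_smul]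
    · simp [add_smul, dA_add, Tens.add_mk]; abel
  zero_smul ξ := by ext <;> simp [dA_zero, Tens.zero_mk]

/-- The 1-jet projection. -/
def proj : J1 X P →ₗ[A] P where
  toFun := J1.pr
  map_add' _ _ := rfl
  map_smul' _ _ := rfl

/-- The 1-jet prolongation `j_d^1`, which sends `p` to `[1 ⊗ 1] ⊗ p`. -/
def prolong (X : ExteriorCalculus k A) (p : P) : J1 X P := ⟨p, 0⟩

@[simp] lemma proj_apply (ξ : J1 X P) : proj ξ = ξ.pr := rfl

end J1

/-! ### Holonomic jets -/

/-- The Spencer operator `S_d^{1,1} : Ω_d^1 ⊗_A J_d^1 P → Ω_d^2 ⊗_A P`, which sends `ω ⊗ ξ` to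
`dω ⊗ π^{1,0}(ξ) + ω ∧ ρ(ξ)`, that is `ω ⊗ [a ⊗ b] ⊗ p` to `d(ωa) b ⊗ p`. -/
def spencer : Tens X 1 (J1 X P) →+ Tens X 2 P :=
  Tens.lift
    (AddMonoidHom.mk'
      (fun ω => AddMonoidHom.mk'
        (fun ξ => Tens.mk X ω.diff ξ.pr + Tens.wedge (rfl : 1 + 1 = 2) ω ξ.rho)
        (fun ξ ζ => by simp [Tens.mk_add]; abel))
      (fun ω η => by
        ext ξ
        have : (ω + η).diff = ω.diff + η.diff := by ext; simp
        simp [this, Tens.add_mk, Tens.wedge_add]; abel))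
    (fun ω a ξ => by
      have h1 : (ω.rmul a).diff = ω.diff.rmul a - ω.wedge (rfl : 1 + 1 = 2) (X.dA a) := by
        ext; simp [d_mul_ι]
      have h2 : Tens.mk X (ω.diff.rmul a - ω.wedge (rfl : 1 + 1 = 2) (X.dA a)) ξ.pr
          = Tens.mk X (ω.diff.rmul a) ξ.pr
            - Tens.mk X (ω.wedge (rfl : 1 + 1 = 2) (X.dA a)) ξ.pr :=
        map_sub ((Tens.mkHom X 2 P).flip ξ.pr) _ _
      simp [h1, h2, Tens.rmul_mk, Tens.wedge_rmul]; abel)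

lemma spencer_mk (ω : X.Form 1) (ξ : J1 X P) :
    spencer (Tens.mk X ω ξ)
      = Tens.mk X ω.diff ξ.pr + Tens.wedge (rfl : 1 + 1 = 2) ω ξ.rho := by
  simp [spencer]

lemma spencer_smul (a : A) (t : Tens X 1 (J1 X P)) :
    spencer (a • t) = a • spencer t
      + Tens.wedge (rfl : 1 + 1 = 2) (X.dA a) (Tens.map J1.proj t) := by
  induction t using Tens.induction with
  | zero => simp
  | mk ω ξ =>
    have : (a • ω).diff = (X.dA a).wedge (rfl : 1 + 1 = 2) ω + a • ω.diff := by
      ext; simp [d_ι_mul]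
    simp [Tens.smul_mk, spencer_mk, this, Tens.add_mk, Tens.wedge_smul]; abel
  | add s t hs ht => simp only [smul_add, map_add, hs, ht]; abel

variable {Q : Type u} [AddCommGroup Q] [Module A Q]

/-- The first component `D^I ∘ J_d^1(l)` of the holonomicity obstruction, for `l : P → J_d^1 Q`,
where `D^I : J_d^1 J_d^1 Q → Ω_d^1 ⊗_A Q` sends `[a ⊗ b] ⊗ [c ⊗ e]` to `a d(bc) ⊗ e`;
equivalently, `D^I` is the difference `J_d^1(π^{1,0}) - π^{1,0}_{J_d^1}`. -/
def obstrI (l : P →ₗ[A] J1 X Q) : J1 X P →+ Tens X 1 Q :=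
  AddMonoidHom.mk' (fun ξ => Tens.map (J1.proj ∘ₗ l) ξ.rho - (l ξ.pr).rho)
    (fun ξ ζ => by simp; abel)

/-- The second component `D^II ∘ J_d^1(l)` of the holonomicity obstruction, where
`D^II : J_d^1 J_d^1 Q → Ω_d^2 ⊗_A Q` sends `[a ⊗ b] ⊗ [c ⊗ e]` to `da ∧ d(bc) ⊗ e`;
equivalently, `D^II` is the composition of `ρ` and the Spencer operator. -/
def obstrII (l : P →ₗ[A] J1 X Q) : J1 X P →+ Tens X 2 Q :=
  AddMonoidHom.mk' (fun ξ => spencer (Tens.map l ξ.rho))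
    (fun ξ ζ => by simp)

lemma obstrI_smul (l : P →ₗ[A] J1 X Q) (a : A) (ξ : J1 X P) :
    obstrI l (a • ξ) = a • obstrI l ξ := by
  simp [obstrI, smul_sub]

lemma obstrII_smul (l : P →ₗ[A] J1 X Q) (a : A) (ξ : J1 X P) :
    obstrII l (a • ξ) = a • obstrII l ξ
      + Tens.wedge (rfl : 1 + 1 = 2) (X.dA a) (obstrI l ξ) := by
  have hd : ((X.dA a).diff : X.Form 2) = 0 := by ext; simp [X.d_d]
  have hm : Tens.map J1.proj (Tens.map l ξ.rho) = Tens.map (J1.proj ∘ₗ l) ξ.rho := by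
    induction ξ.rho using Tens.induction with
    | zero => simp
    | mk ω p => simp
    | add s t hs ht => simp only [map_add, hs, ht]
  simp [obstrI, obstrII, spencer_smul, spencer_mk, hd, hm, Tens.zero_mk]
  abel

/-- The kernel of `D ∘ J_d^1(l) : J_d^1 P → (Ω_d^1 ⋉ Ω_d^2) Q`, where `D = (D^I, D^II)`. -/
def holonomic (l : P →ₗ[A] J1 X Q) : Submodule A (J1 X P) where
  carrier := {ξ | obstrI l ξ = 0 ∧ obstrII l ξ = 0}
  add_mem' {ξ ζ} h h' := by simp [h.1, h.2, h'.1, h'.2]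
  zero_mem' := by simp
  smul_mem' a ξ h := by simp [obstrI_smul, obstrII_smul, h.1, h.2]

variable (X)

/-- Two consecutive holonomic jet modules `J_d^n E` and `J_d^{n+1} E`, with the inclusion of the
latter in `J_d^1 J_d^n E` and with the two prolongations. -/
structure JetStage (E : Type u) where
  /-- the module `J_d^n E` -/
  Prev : Type u
  [prevGroup : AddCommGroup Prev]
  [prevModule : Module A Prev]
  /-- the module `J_d^{n+1} E` -/
  Cur : Type u
  [curGroup : AddCommGroup Cur]
  [curModule : Module A Cur]
  l : Cur →ₗ[A] J1 X Prev
  jPrev : E → Prev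
  jCur : E → Cur
  l_jCur : ∀ e, l (jCur e) = J1.prolong X (jPrev e)

attribute [instance] JetStage.prevGroup JetStage.prevModule JetStage.curGroup JetStage.curModule

/-- `J_d^{n+2} E` is the kernel of `D ∘ J_d^1(l^{n+1}) : J_d^1 J_d^{n+1} E → (Ω_d^1 ⋉ Ω_d^2) J_d^n E`
and `j_d^{n+2}` is the unique factorization of `j_d^1 ∘ j_d^{n+1}` through it. -/
def JetStage.next {E : Type u} (S : JetStage X E) : JetStage X E where
  Prev := S.Cur
  Cur := holonomic S.l
  l := (holonomic S.l).subtype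
  jPrev := S.jCur
  jCur e := ⟨J1.prolong X (S.jCur e), by
    constructor
    · simp [obstrI, J1.prolong, S.l_jCur]
    · simp [obstrII, J1.prolong]⟩
  l_jCur _ := rfl

variable (E : Type u) [AddCommGroup E] [Module A E]

/-- The pair of `J_d^n E` and `J_d^{n+1} E`, starting from `J_d^0 E = E` and `J_d^1 E`. -/
def jetStage : ℕ → JetStage X E
  | 0 =>
    { Prev := E
      Cur := J1 X E
      l := LinearMap.id
      jPrev := id
      jCur := J1.prolong X
      l_jCur := fun _ => rfl }
  | n + 1 => (jetStage n).next

/-- The holonomic `n`-jet module `J_d^n E`. -/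
def Jet (n : ℕ) : Type u := (jetStage X E n).Prev

instance (n : ℕ) : AddCommGroup (Jet X E n) := (jetStage X E n).prevGroup
instance (n : ℕ) : Module A (Jet X E n) := (jetStage X E n).prevModule

variable {E}

/-- The `n`-jet prolongation `j_d^n : E → J_d^n E`. -/
def jet (n : ℕ) : E → Jet X E n := (jetStage X E n).jPrev

variable (E)

/-- The inclusion `l_d^{n+1} : J_d^{n+1} E → J_d^1 J_d^n E`. -/
def jetIncl (n : ℕ) : Jet X E (n + 1) →ₗ[A] J1 X (Jet X E n) := (jetStage X E n).l

/-- The jet projection `π_d^{n+1,n} : J_d^{n+1} E → J_d^n E`. -/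
def jetProj (n : ℕ) : Jet X E (n + 1) →ₗ[A] Jet X E n := J1.proj ∘ₗ jetIncl X E n

lemma jetProj_jet (n : ℕ) (e : E) : jetProj X E n (jet X (n + 1) e) = jet X n e :=
  congrArg J1.pr ((jetStage X E n).l_jCur e)

end Jet

/-! ### Linear differential operators and symbols -/

section Diff

variable (E : Type u) [AddCommGroup E] [Module k E] [Module A E]
variable (F : Type u) [AddCommGroup F] [Module k F] [Module A F] [IsScalarTower k A F]

/-- `Diff_d^n(E, F)`: the linear differential operators of order at most `n`, that is the `k`-linear
maps `Δ : E → F` that factor as an `A`-linear map `J_d^n E → F` after `j_d^n`; as a module over the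
ring `Hom_A(F, F)`, which acts by composition. -/
def DiffOrd (n : ℕ) : Submodule (Module.End A F) (E →ₗ[k] F) where
  carrier := {Δ | ∃ L : Jet X E n →ₗ[A] F, ∀ e, L (jet X n e) = Δ e}
  add_mem' := by
    rintro Δ Δ' ⟨L, hL⟩ ⟨L', hL'⟩
    exact ⟨L + L', fun e => by simp [hL, hL']⟩
  zero_mem' := ⟨0, fun e => rfl⟩
  smul_mem' := by
    rintro f Δ ⟨L, hL⟩
    exact ⟨f ∘ₗ L, fun e => by simp [hL]⟩

lemma diffOrd_le_succ (n : ℕ) : DiffOrd X E F n ≤ DiffOrd X E F (n + 1) := by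
  rintro Δ ⟨L, hL⟩
  exact ⟨L ∘ₗ jetProj X E n, fun e => by simp [jetProj_jet, hL]⟩

lemma diffOrd_mono : Monotone (DiffOrd X E F) := monotone_nat_of_le_succ (diffOrd_le_succ X E F)

/-- `Diff_d(E, F)`: the linear differential operators of finite order. -/
def Diff : Submodule (Module.End A F) (E →ₗ[k] F) where
  carrier := {Δ | ∃ n, Δ ∈ DiffOrd X E F n}
  add_mem' := by
    rintro Δ Δ' ⟨n, h⟩ ⟨n', h'⟩
    exact ⟨max n n', add_mem (diffOrd_mono X E F (le_max_left n n') h)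
      (diffOrd_mono X E F (le_max_right n n') h')⟩
  zero_mem' := ⟨0, zero_mem _⟩
  smul_mem' := by
    rintro f Δ ⟨n, h⟩
    exact ⟨n, Submodule.smul_mem _ f h⟩

lemma diffOrd_le (n : ℕ) : DiffOrd X E F n ≤ Diff X E F := fun _ h => ⟨n, h⟩

/-- `Diff_d^{n-1}(E, F)`, with the convention `Diff_d^{-1}(E, F) = 0`. -/
def DiffPred : ℕ → Submodule (Module.End A F) (E →ₗ[k] F)
  | 0 => ⊥
  | n + 1 => DiffOrd X E F n

/-- The symbols of order `n`: `Symb_d^n(E, F) = Diff_d^n(E, F) / Diff_d^{n-1}(E, F)`. -/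
def Symb (n : ℕ) : Type u := DiffOrd X E F n ⧸ (DiffPred X E F n).submoduleOf (DiffOrd X E F n)

instance (n : ℕ) : AddCommGroup (Symb X E F n) := inferInstanceAs
  (AddCommGroup (DiffOrd X E F n ⧸ (DiffPred X E F n).submoduleOf (DiffOrd X E F n)))

instance (n : ℕ) : Module (Module.End A F) (Symb X E F n) := inferInstanceAs
  (Module (Module.End A F) (DiffOrd X E F n ⧸ (DiffPred X E F n).submoduleOf (DiffOrd X E F n)))

instance (n : ℕ) : Module k (Symb X E F n) := inferInstanceAs
  (Module k (DiffOrd X E F n ⧸ (DiffPred X E F n).submoduleOf (DiffOrd X E F n)))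

/-- The symbol map `ς_d^n : Diff_d^n(E, F) → Symb_d^n(E, F)`. -/
def symbol (n : ℕ) : DiffOrd X E F n →ₗ[Module.End A F] Symb X E F n :=
  ((DiffPred X E F n).submoduleOf (DiffOrd X E F n)).mkQ

lemma symbol_surjective (n : ℕ) : Function.Surjective (symbol X E F n) :=
  Submodule.mkQ_surjective _

lemma symbol_eq_zero_iff (n : ℕ) (Δ : DiffOrd X E F n) :
    symbol X E F n Δ = 0 ↔ (Δ : E →ₗ[k] F) ∈ DiffPred X E F n :=
  Submodule.Quotient.mk_eq_zero _

/-- The graded symbol module `Symb_d^•(E, F) = ⨁ n, Symb_d^n(E, F)`. -/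
abbrev SymbTotal : Type u := ⨁ n, Symb X E F n

/-! ### Quantizations and total symbols -/

/-- A full quantization for `(E, F)`: for every `n` an `n`-quantization, that is
a `Hom_A(F, F)`-linear right splitting `q^n` of the symbol map `ς_d^n`. -/
structure Quantization where
  q : ∀ n, Symb X E F n →ₗ[Module.End A F] DiffOrd X E F n
  symbol_q : ∀ n σ, symbol X E F n (q n σ) = σ

namespace Quantization

variable {X E F} (Q : Quantization X E F)

/-- The full quantization as a map `q = ∑ q^n : Symb_d^•(E, F) → Diff_d(E, F)`. -/
def total : SymbTotal X E F →ₗ[Module.End A F] Diff X E F :=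
  DirectSum.toModule _ _ _ (fun n => Submodule.inclusion (diffOrd_le X E F n) ∘ₗ Q.q n)

/-- The step `T ↦ T - q^{m+1}(ς_d^{m+1}(T))` of the recursion for truncations; it lands in
`Diff_d^m(E, F)` as the symbol of the result vanishes. -/
def truncStep (m : ℕ) (T : DiffOrd X E F (m + 1)) : DiffOrd X E F m :=
  ⟨(T - Q.q (m + 1) (symbol X E F (m + 1) T) : DiffOrd X E F (m + 1)), by
    have h : symbol X E F (m + 1) (T - Q.q (m + 1) (symbol X E F (m + 1) T)) = 0 := by
      rw [map_sub, Q.symbol_q, sub_self]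
    exact (symbol_eq_zero_iff X E F (m + 1) _).1 h⟩

/-- The `m`-truncation of a differential operator `Δ` of order at most `n`: it is `Δ` for `m ≥ n`,
and below `n` it is given by descending recursion. -/
def truncOf (n : ℕ) (Δ : DiffOrd X E F n) (m : ℕ) : DiffOrd X E F m :=
  if h : m ≤ n then
    Nat.decreasingInduction (motive := fun i _ => DiffOrd X E F i)
      (fun i _ T => Q.truncStep i T) Δ h
  else Submodule.inclusion (diffOrd_mono X E F (not_le.1 h).le) Δ

open Classical in
/-- The order of a differential operator of finite order. -/
def order (Δ : Diff X E F) : ℕ := Nat.find Δ.2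

lemma mem_order (Δ : Diff X E F) : (Δ : E →ₗ[k] F) ∈ DiffOrd X E F (order Δ) := by
  classical exact Nat.find_spec Δ.2

/-- The `m`-truncation of a differential operator of finite order. -/
def trunc (Δ : Diff X E F) (m : ℕ) : DiffOrd X E F m := Q.truncOf (order Δ) ⟨Δ, mem_order Δ⟩ m

/-- The component `[Δ]_q^m = ς_d^m(trunc_m Δ)`. -/
def part (Δ : Diff X E F) (m : ℕ) : Symb X E F m := symbol X E F m (Q.trunc Δ m)

lemma part_eq_zero (Δ : Diff X E F) (m : ℕ) (h : order Δ < m) : Q.part Δ m = 0 := by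
  obtain ⟨m, rfl⟩ := Nat.exists_eq_succ_of_ne_zero (Nat.ne_of_gt (Nat.zero_lt_of_lt h))
  refine (symbol_eq_zero_iff X E F (m + 1) _).2 ?_
  change ((Q.trunc Δ (m + 1) : DiffOrd X E F (m + 1)) : E →ₗ[k] F) ∈ DiffOrd X E F m
  rw [trunc, truncOf, dif_neg (not_le.2 h)]
  exact diffOrd_mono X E F (Nat.lt_succ_iff.1 h) (mem_order Δ)

/-- The total symbol `ς_q(Δ) = ∑_m [Δ]_q^m`, the element of `Symb_d^•(E, F)` with the components
`[Δ]_q^m`. -/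
def totalSymbol (Δ : Diff X E F) : SymbTotal X E F :=
  DirectSum.mk (fun m => Symb X E F m) (Finset.range (order Δ + 1)) (fun m => Q.part Δ m)

lemma totalSymbol_apply (Δ : Diff X E F) (m : ℕ) : Q.totalSymbol Δ m = Q.part Δ m := by
  by_cases h : m ∈ Finset.range (order Δ + 1)
  · exact DirectSum.mk_apply_of_mem h
  · rw [Q.part_eq_zero Δ m (by simpa using h)]
    exact DirectSum.mk_apply_of_notMem h

/-- The `m`-homogeneous component `Δ_q^{(m)} = q^m([Δ]_q^m)` of `Δ`. -/
def component (Δ : Diff X E F) (m : ℕ) : Diff X E F :=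
  Submodule.inclusion (diffOrd_le X E F m) (Q.q m (Q.part Δ m))

end Quantization

end Diff

/-! ### Naturality in the second argument -/

section Naturality

variable (E : Type u) [AddCommGroup E] [Module k E] [Module A E]

section Maps

variable {F : Type u} [AddCommGroup F] [Module k F] [Module A F] [IsScalarTower k A F]
variable {G : Type u} [AddCommGroup G] [Module k G] [Module A G] [IsScalarTower k A G]

/-- Composition with an `A`-linear map `f : F → G`, as a map `Diff_d^n(E, F) → Diff_d^n(E, G)`. -/
def DiffOrd.map (f : F →ₗ[A] G) (n : ℕ) : DiffOrd X E F n →ₗ[k] DiffOrd X E G n where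
  toFun Δ := ⟨f.restrictScalars k ∘ₗ Δ.1, by
    obtain ⟨L, hL⟩ := Δ.2
    exact ⟨f ∘ₗ L, fun e => by simp [hL]⟩⟩
  map_add' _ _ := Subtype.ext (LinearMap.comp_add _ _ _)
  map_smul' c Δ := Subtype.ext (by ext e; exact (f.restrictScalars k).map_smul c (Δ.1 e))

/-- Composition with an `A`-linear map `f : F → G`, as a map `Diff_d(E, F) → Diff_d(E, G)`. -/
def Diff.map (f : F →ₗ[A] G) : Diff X E F →ₗ[k] Diff X E G where
  toFun Δ := ⟨f.restrictScalars k ∘ₗ Δ.1, by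
    obtain ⟨n, h⟩ := Δ.2
    exact ⟨n, (DiffOrd.map X E f n ⟨Δ.1, h⟩).2⟩⟩
  map_add' _ _ := Subtype.ext (LinearMap.comp_add _ _ _)
  map_smul' c Δ := Subtype.ext (by ext e; exact (f.restrictScalars k).map_smul c (Δ.1 e))

/-- The symbol map as a `k`-linear map. -/
def symbolK (F : Type u) [AddCommGroup F] [Module k F] [Module A F] [IsScalarTower k A F]
    (n : ℕ) : DiffOrd X E F n →ₗ[k] Symb X E F n :=
  { symbol X E F n with map_smul' := fun _ _ => rfl }

/-- The inclusion of `Diff_d^n(E, F)` in `Diff_d(E, F)` as a `k`-linear map. -/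
def diffInclK (F : Type u) [AddCommGroup F] [Module k F] [Module A F] [IsScalarTower k A F]
    (n : ℕ) : DiffOrd X E F n →ₗ[k] Diff X E F :=
  { Submodule.inclusion (diffOrd_le X E F n) with map_smul' := fun _ _ => rfl }

/-- The map `Symb_d^n(E, F) → Symb_d^n(E, G)` induced by an `A`-linear map `f : F → G`. -/
def Symb.map (f : F →ₗ[A] G) (n : ℕ) : Symb X E F n →ₗ[k] Symb X E G n where
  toFun := QuotientAddGroup.map
    ((DiffPred X E F n).submoduleOf (DiffOrd X E F n)).toAddSubgroup
    ((DiffPred X E G n).submoduleOf (DiffOrd X E G n)).toAddSubgroup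
    (DiffOrd.map X E f n).toAddMonoidHom (by
    rintro Δ hΔ
    cases n with
    | zero =>
      have h : (Δ : E →ₗ[k] F) = 0 := hΔ
      change f.restrictScalars k ∘ₗ (Δ : E →ₗ[k] F) = 0
      rw [h, LinearMap.comp_zero]
    | succ n => exact (DiffOrd.map X E f n ⟨Δ.1, hΔ⟩).2)
  map_add' σ τ := map_add (QuotientAddGroup.map _ _ _ _) σ τ
  map_smul' c σ := by
    obtain ⟨Δ, rfl⟩ := symbol_surjective X E _ _ σ
    exact congrArg (symbolK X E G n) ((DiffOrd.map X E f n).map_smul c Δ)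

lemma Symb.map_symbol (f : F →ₗ[A] G) (n : ℕ) (Δ : DiffOrd X E F n) :
    Symb.map X E f n (symbol X E F n Δ) = symbol X E G n (DiffOrd.map X E f n Δ) := rfl

end Maps

/-- The canonical `k`-module structure on a left `A`-module. -/
@[reducible]
def canonicalModule (k : Type w) [CommRing k] {A : Type u} [Ring A] [Algebra k A]
    (F : ModuleCat.{u} A) : Module k F := Module.restrictScalars k A F

attribute [local instance] canonicalModule

lemma canonicalModule_tower (k : Type w) [CommRing k] {A : Type u} [Ring A] [Algebra k A]
    (F : ModuleCat.{u} A) : IsScalarTower k A F := IsScalarTower.restrictScalars k A F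

attribute [local instance] canonicalModule_tower

/-- The functor `Diff_d^n(E, -)` from left `A`-modules to `k`-modules. -/
def diffOrdFunctor (n : ℕ) : ModuleCat.{u} A ⥤ ModuleCat.{u} k where
  obj F := ModuleCat.of k (DiffOrd X E F n)
  map f := ModuleCat.ofHom (DiffOrd.map X E f.hom n)

/-- The functor `Diff_d(E, -)` from left `A`-modules to `k`-modules. -/
def diffFunctor : ModuleCat.{u} A ⥤ ModuleCat.{u} k where
  obj F := ModuleCat.of k (Diff X E F)
  map f := ModuleCat.ofHom (Diff.map X E f.hom)

/-- The functor `Symb_d^n(E, -)` from left `A`-modules to `k`-modules. -/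
def symbFunctor (n : ℕ) : ModuleCat.{u} A ⥤ ModuleCat.{u} k where
  obj F := ModuleCat.of k (Symb X E F n)
  map f := ModuleCat.ofHom (Symb.map X E f.hom n)
  map_id F := by
    ext σ
    obtain ⟨Δ, rfl⟩ := symbol_surjective X E _ _ σ
    rfl
  map_comp f g := by
    ext σ
    obtain ⟨Δ, rfl⟩ := symbol_surjective X E _ _ σ
    rfl

/-- The functor `Symb_d^•(E, -)` from left `A`-modules to `k`-modules. -/
def symbTotalFunctor : ModuleCat.{u} A ⥤ ModuleCat.{u} k where
  obj F := ModuleCat.of k (SymbTotal X E F)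
  map f := ModuleCat.ofHom (DirectSum.lmap (fun n => Symb.map X E f.hom n))
  map_id F := by
    ext n σ : 3
    obtain ⟨Δ, rfl⟩ := symbol_surjective X E _ _ σ
    simp
    rfl
  map_comp f g := by
    ext n σ : 3
    obtain ⟨Δ, rfl⟩ := symbol_surjective X E _ _ σ
    simp
    rfl

/-- The symbol map as a natural transformation `Diff_d^n(E, -) → Symb_d^n(E, -)`. -/
def symbolNat (n : ℕ) : diffOrdFunctor X E n ⟶ symbFunctor X E n where
  app F := ModuleCat.ofHom (symbolK X E F n)

/-- A natural full quantization for `E`: for every `n` a natural `n`-quantization, that is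
a natural transformation `q^n : Symb_d^n(E, -) → Diff_d^n(E, -)` of functors from left
`A`-modules to `k`-modules with `ς_d^n ∘ q^n = id`. -/
structure NaturalQuantization where
  q : ∀ n, symbFunctor X E n ⟶ diffOrdFunctor X E n
  q_symbol : ∀ n, q n ≫ symbolNat X E n = 𝟙 (symbFunctor X E n)

namespace NaturalQuantization

variable {X E} (Q : NaturalQuantization X E)

/-- The component `q_F^n : Symb_d^n(E, F) → Diff_d^n(E, F)`. -/
def qHom (n : ℕ) (F : ModuleCat.{u} A) : Symb X E F n →ₗ[k] DiffOrd X E F n :=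
  ((Q.q n).app F).hom

/-- The component of a natural full quantization at `F`, a full quantization for `(E, F)`;
its linearity over `Hom_A(F, F)` is the naturality with respect to endomorphisms of `F`. -/
def onModule (F : ModuleCat.{u} A) : Quantization X E F where
  q n :=
    { toFun := Q.qHom n F
      map_add' := map_add _
      map_smul' := fun f σ => by
        obtain ⟨Δ, rfl⟩ := symbol_surjective X E _ _ σ
        exact congrArg (fun φ => φ.hom (symbol X E F n Δ)) ((Q.q n).naturality (ModuleCat.ofHom f)) }
  symbol_q n σ := congrArg (fun φ => (φ.app F).hom σ) (Q.q_symbol n)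

/-- A natural full quantization as a natural transformation
`q = ∑ q^n : Symb_d^•(E, -) → Diff_d(E, -)`. -/
def total : symbTotalFunctor X E ⟶ diffFunctor X E where
  app F := ModuleCat.ofHom (DirectSum.toModule k ℕ (Diff X E F)
    (fun n => diffInclK X E F n ∘ₗ Q.qHom n F))
  naturality F G f := by
    refine ModuleCat.hom_ext (DirectSum.linearMap_ext k fun n => LinearMap.ext fun σ => ?_)
    have h := congrArg (fun φ => diffInclK X E G n (φ.hom σ)) ((Q.q n).naturality f)
    change DirectSum.toModule k ℕ (Diff X E G)
        (fun n => diffInclK X E G n ∘ₗ Q.qHom n G)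
        (DirectSum.lmap (fun n => Symb.map X E f.hom n) (DirectSum.lof k ℕ (Symb X E F) n σ))
      = Diff.map X E f.hom (DirectSum.toModule k ℕ (Diff X E F)
        (fun n => diffInclK X E F n ∘ₗ Q.qHom n F) (DirectSum.lof k ℕ (Symb X E F) n σ))
    rw [DirectSum.lmap_lof, DirectSum.toModule_lof, DirectSum.toModule_lof]
    exact h

/-- The total symbol maps `ς_{q_F} : Diff_d(E, F) → Symb_d^•(E, F)`. -/
def totalSymbol (F : ModuleCat.{u} A) :
    (diffFunctor X E).obj F → (symbTotalFunctor X E).obj F :=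
  (Q.onModule F).totalSymbol

end NaturalQuantization

end Naturality

end NCJet

end

namespace NCJet

noncomputable section

variable {k : Type w} [CommRing k] {A : Type u} [Ring A] [Algebra k A]
variable {X : ExteriorCalculus k A}
variable {E : Type u} [AddCommGroup E] [Module k E] [Module A E]

/-! ### Truncations and the decomposition of an operator -/

namespace Quantization

variable {F : Type u} [AddCommGroup F] [Module k F] [Module A F] [IsScalarTower k A F]
variable (Q : Quantization X E F)

/-! A full quantization splits the order filtration one degree at a time, and the filtration is
exhaustive and starts from `Diff_d^{-1} = 0`; such a filtered module is the direct sum of its graded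
pieces.

Surjectivity of `q` is a telescoping sum. By the recursion, two consecutive truncations `Δ_{m+1}`
and `Δ_m` differ by the homogeneous component of degree `m+1`, and `Δ_0` is its own component of
degree zero because `ς_d^0` is injective. Adding up to the order of `Δ`, where the truncation is `Δ`
itself, gives `q(ς_q(Δ)) = Δ` (`sum_component`, `total_totalSymbol`).

Injectivity comes from the leading term. If `∑_{i ≤ n} q^i(σ_i) = 0`, then `q^n(σ_n)` is minus a sum
of operators of order below `n`, so its symbol `σ_n` vanishes; descent on `n` removes the other
terms (`eq_zero_of_sum_q_eq_zero`, `total_injective`). An injective map with a right inverse is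
bijective, so `ς_q` is also a left inverse, and its linearity follows from that of `q`.

For a natural quantization, each component of `q` is the map just treated (`total_app_apply`). A
natural transformation with bijective components is an isomorphism, so the naturality of the maps
`ς_{q_F}` comes for free. -/

lemma truncOf_self (n : ℕ) (Δ : DiffOrd X E F n) : Q.truncOf n Δ n = Δ := by
  rw [truncOf, dif_pos le_rfl, Nat.decreasingInduction_self]

lemma truncOf_of_lt (n : ℕ) (Δ : DiffOrd X E F n) (m : ℕ) (h : m < n) :
    Q.truncOf n Δ m = Q.truncStep m (Q.truncOf n Δ (m + 1)) := by
  rw [truncOf, truncOf, dif_pos h.le, dif_pos (Nat.succ_le_of_lt h),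
    Nat.decreasingInduction_succ_left]

/-- Base of the telescoping sum: there are no nonzero operators of order `-1`, so `ς_d^0` is
injective and its section `q^0` is a two-sided inverse. -/
lemma coe_q_symbol_zero (T : DiffOrd X E F 0) :
    (Q.q 0 (symbol X E F 0 T) : E →ₗ[k] F) = T := by
  have h : symbol X E F 0 (T - Q.q 0 (symbol X E F 0 T)) = 0 := by
    rw [map_sub, Q.symbol_q, sub_self]
  -- Membership in `DiffPred X E F 0 = ⊥` is by definition equality with zero.
  have h' : ((T - Q.q 0 (symbol X E F 0 T) : DiffOrd X E F 0) : E →ₗ[k] F) = 0 :=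
    (symbol_eq_zero_iff X E F 0 _).1 h
  exact (sub_eq_zero.1 h').symm

/-- A truncation of `Δ` is the sum of the homogeneous components of lower or equal degree. -/
lemma sum_component_eq_trunc (Δ : Diff X E F) (m : ℕ) (h : m ≤ order Δ) :
    ∑ i ∈ Finset.range (m + 1), (Q.component Δ i : E →ₗ[k] F) = Q.trunc Δ m := by
  induction m with
  | zero =>
    rw [Finset.sum_range_one]
    exact Q.coe_q_symbol_zero (Q.trunc Δ 0)
  | succ m ih =>
    rw [Finset.sum_range_succ, ih (Nat.le_of_succ_le h), trunc, Q.truncOf_of_lt _ _ m h]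
    -- The truncation at `m` is `T - q^{m+1}(ς_d^{m+1}(T))`, where `T` is the truncation at `m + 1`;
    -- the added component is exactly the subtracted term.
    exact sub_add_cancel _ _

lemma sum_component (Δ : Diff X E F) :
    ∑ i ∈ Finset.range (order Δ + 1), Q.component Δ i = Δ := by
  refine Subtype.ext ?_
  rw [AddSubmonoidClass.coe_finsetSum, Q.sum_component_eq_trunc Δ _ le_rfl, trunc, truncOf_self]

lemma component_eq_zero (Δ : Diff X E F) (m : ℕ) (h : order Δ < m) : Q.component Δ m = 0 := by
  rw [component, Q.part_eq_zero Δ m h, map_zero, map_zero]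

lemma support_component_subset (Δ : Diff X E F) :
    Function.support (Q.component Δ) ⊆ Finset.range (order Δ + 1) := by
  intro m hm
  by_contra h
  exact hm (Q.component_eq_zero Δ m (by simpa using h))

/-! ### The map `q` on finite families of symbols -/

lemma total_lof (n : ℕ) (σ : Symb X E F n) :
    Q.total (DirectSum.lof (Module.End A F) ℕ (fun n => Symb X E F n) n σ)
      = Submodule.inclusion (diffOrd_le X E F n) (Q.q n σ) :=
  DirectSum.toModule_lof _ _ _

/-- Links the two presentations of the direct sum: `totalSymbol` is given by `DirectSum.mk`, whereas
`total` is determined by its values on single summands. -/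
lemma total_mk (s : Finset ℕ) (f : ∀ n, Symb X E F n) :
    Q.total (DirectSum.mk (fun n => Symb X E F n) s (fun n => f n))
      = ∑ n ∈ s, Submodule.inclusion (diffOrd_le X E F n) (Q.q n (f n)) := by
  classical
  have h : DirectSum.mk (fun n => Symb X E F n) s (fun n => f n)
      = ∑ n ∈ s, DirectSum.lof (Module.End A F) ℕ (fun n => Symb X E F n) n (f n) := by
    refine DFinsupp.ext fun m => ?_
    rw [DFinsupp.finsetSum_apply]
    by_cases hm : m ∈ s
    · rw [Finset.sum_eq_single_of_mem m hm]
      · exact (DirectSum.mk_apply_of_mem hm).trans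
          (DirectSum.of_eq_same (β := fun n => Symb X E F n) m (f m)).symm
      · intro n _ hn
        exact DirectSum.of_eq_of_ne (β := fun n => Symb X E F n) n m (f n) hn.symm
    · rw [Finset.sum_eq_zero]
      · exact DirectSum.mk_apply_of_notMem hm
      · intro n hn
        exact DirectSum.of_eq_of_ne (β := fun n => Symb X E F n) n m (f n)
          (fun e => hm (e ▸ hn))
  rw [h, map_sum]
  exact Finset.sum_congr rfl fun n _ => Q.total_lof n (f n)

/-- The sum produced by `total_mk` is, by definition, the sum of the homogeneous components of `Δ`
up to its order. -/
lemma total_totalSymbol (Δ : Diff X E F) : Q.total (Q.totalSymbol Δ) = Δ :=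
  (Q.total_mk _ (Q.part Δ)).trans (Q.sum_component Δ)

/-! ### Injectivity of `q` and its inverse -/

/-- All terms below degree `n` are invisible to `ς_d^n`. For `n = 0` the sum is empty, in agreement
with `DiffPred X E F 0 = ⊥`. -/
lemma sum_q_mem_diffPred (f : ∀ n, Symb X E F n) (n : ℕ) :
    ∑ i ∈ Finset.range n, (Q.q i (f i) : E →ₗ[k] F) ∈ DiffPred X E F n := by
  cases n with
  | zero => simp
  | succ n =>
    exact sum_mem fun i hi =>
      diffOrd_mono X E F (Nat.lt_succ_iff.1 (Finset.mem_range.1 hi)) (Q.q i (f i)).2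

/-- The images of the maps `q^n` are independent. -/
lemma eq_zero_of_sum_q_eq_zero (f : ∀ n, Symb X E F n) (n : ℕ)
    (h : ∑ i ∈ Finset.range n, (Q.q i (f i) : E →ₗ[k] F) = 0) : ∀ i < n, f i = 0 := by
  induction n with
  | zero => intro i hi; exact absurd hi (Nat.not_lt_zero i)
  | succ n ih =>
    rw [Finset.sum_range_succ] at h
    -- The leading symbol is recovered as `ς_d^n(q^n(f n))`, and the vanishing sum rewrites `q^n(f
    -- n)` as minus the terms of lower degree.
    have hn : f n = 0 := by
      rw [← Q.symbol_q n (f n), symbol_eq_zero_iff, eq_neg_of_add_eq_zero_right h]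
      exact neg_mem (Q.sum_q_mem_diffPred f n)
    rw [hn, map_zero, ZeroMemClass.coe_zero, add_zero] at h
    intro i hi
    obtain hi | rfl := Nat.lt_succ_iff_lt_or_eq.1 hi
    · exact ih h i hi
    · exact hn

lemma total_injective : Function.Injective Q.total := by
  classical
  refine (injective_iff_map_eq_zero _).2 fun σ hσ => ?_
  obtain ⟨n, hn⟩ : ∃ n, ∀ m ∉ Finset.range n, σ m = 0 := by
    obtain ⟨n, hn⟩ := Finset.exists_nat_subset_range (DFinsupp.support σ)
    exact ⟨n, fun m hm => by_contra fun h => hm (hn (DFinsupp.mem_support_iff.2 h))⟩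
  -- The support of `σ` lies in an initial segment, so `σ` can be written in the form that
  -- `total_mk` handles.
  have e : DirectSum.mk (fun n => Symb X E F n) (Finset.range n) (fun m => σ m) = σ := by
    refine DFinsupp.ext fun m => ?_
    by_cases hm : m ∈ Finset.range n
    · exact DirectSum.mk_apply_of_mem hm
    · exact (DirectSum.mk_apply_of_notMem hm).trans (hn m hm).symm
  rw [← e, Q.total_mk] at hσ
  have h := congrArg (fun Δ : Diff X E F => (Δ : E →ₗ[k] F)) hσ
  simp only [AddSubmonoidClass.coe_finsetSum] at h
  refine DFinsupp.ext fun m => ?_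
  by_cases hm : m ∈ Finset.range n
  · exact Q.eq_zero_of_sum_q_eq_zero (fun m => σ m) n h m (Finset.mem_range.1 hm)
  · exact hn m hm

/-- A right inverse of an injective map is a left inverse; the truncations of `q(σ)` need not be
computed. -/
lemma totalSymbol_total (σ : SymbTotal X E F) : Q.totalSymbol (Q.total σ) = σ :=
  Q.total_injective (Q.total_totalSymbol _)

/-- A full quantization as an isomorphism `Diff_d(E, F) ≃ Symb_d^•(E, F)`. -/
def totalSymbolEquiv : Diff X E F ≃ₗ[Module.End A F] SymbTotal X E F :=
  -- The equivalence is built in the direction of `total`, whose linearity is known, and then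
  -- inverted. Additivity of `totalSymbol` is not evident from its definition, which depends on the
  -- order of the operator.
  ({ Q.total with
    invFun := Q.totalSymbol
    left_inv := Q.totalSymbol_total
    right_inv := Q.total_totalSymbol } : SymbTotal X E F ≃ₗ[Module.End A F] Diff X E F).symm

end Quantization

/-! ### Natural full quantizations -/

namespace NaturalQuantization

attribute [local instance] canonicalModule canonicalModule_tower

variable (Q : NaturalQuantization X E)

/-- Transfers the results for a fixed `F` to the components of the natural transformation. The two
maps are linear over different rings, `k` and `Hom_A(F, F)`, so they are compared as additive maps
on each summand, where both are `q_F^n`. -/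
lemma total_app_apply (F : ModuleCat.{u} A) (σ : SymbTotal X E F) :
    (Q.total.app F).hom σ = (Q.onModule F).total σ := by
  refine DFunLike.congr_fun (f := ((Q.total.app F).hom.toAddMonoidHom :
    SymbTotal X E F →+ Diff X E F)) (g := (Q.onModule F).total.toAddMonoidHom) ?_ σ
  refine DirectSum.addHom_ext fun n τ => ?_
  have h := DirectSum.toModule_lof k (φ := fun n => diffInclK X E F n ∘ₗ Q.qHom n F) n τ
  exact h.trans ((Q.onModule F).total_lof n τ).symm

lemma total_app_totalSymbol (F : ModuleCat.{u} A) (Δ : (diffFunctor X E).obj F) :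
    (Q.total.app F).hom (Q.totalSymbol F Δ) = Δ :=
  (Q.total_app_apply F _).trans ((Q.onModule F).total_totalSymbol Δ)

lemma isIso_total : IsIso Q.total := by
  have (F : ModuleCat.{u} A) : IsIso (Q.total.app F) := by
    refine (ConcreteCategory.isIso_iff_bijective _).2
      (Function.bijective_iff_has_inverse.2 ⟨Q.totalSymbol F, fun σ => ?_, fun Δ => ?_⟩)
    · exact (congrArg (Q.totalSymbol F) (Q.total_app_apply F σ)).trans
        ((Q.onModule F).totalSymbol_total σ)
    · exact Q.total_app_totalSymbol F Δ
  -- Pointwise invertibility suffices: the inverses of the components of a natural transformation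
  -- are automatically natural.
  exact NatIso.isIso_of_isIso_app _

end NaturalQuantization

end

end NCJet

theorem proposition5p24 {k : Type w} [CommRing k] {A : Type u} [Ring A] [Algebra k A]
    (X : NCJet.ExteriorCalculus k A)
    (E : Type u) [AddCommGroup E] [Module k E] [Module A E] [IsScalarTower k A E] :
    (∀ (F : Type u) [AddCommGroup F] [Module k F] [Module A F] [IsScalarTower k A F]
        (Q : NCJet.Quantization X E F),
      (∃ Φ : NCJet.Diff X E F ≃ₗ[Module.End A F] NCJet.SymbTotal X E F,
        (∀ Δ, Φ Δ = Q.totalSymbol Δ) ∧ ∀ σ, Φ.symm σ = Q.total σ) ∧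
      ∀ Δ : NCJet.Diff X E F, (Function.support (Q.component Δ)).Finite ∧
        Δ = ∑ᶠ m, Q.component Δ m) ∧
    (∀ Q : NCJet.NaturalQuantization X E,
      ∃ Φ : NCJet.diffFunctor X E ≅ NCJet.symbTotalFunctor X E,
        Φ.inv = Q.total ∧
        ∀ (F : ModuleCat.{u} A) (Δ : (NCJet.diffFunctor X E).obj F),
          (Φ.hom.app F).hom Δ = Q.totalSymbol F Δ) := by
  refine ⟨fun F _ _ _ _ Q => ⟨⟨Q.totalSymbolEquiv, fun _ => rfl, fun _ => rfl⟩, fun Δ => ⟨?_, ?_⟩⟩,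
    fun Q => ?_⟩
  · exact (Finset.finite_toSet _).subset (Q.support_component_subset Δ)
  · rw [finsum_eq_sum_of_support_subset _ (Q.support_component_subset Δ), Q.sum_component]
  · have := Q.isIso_total
    refine ⟨(asIso Q.total).symm, rfl, fun F Δ => ?_⟩
    -- The categorical inverse is identified by writing `Δ` as `q_F(ς_{q_F}(Δ))` and cancelling
    -- `q_F`.
    have h := congrArg (fun φ => (φ.app F).hom (Q.totalSymbol F Δ)) (IsIso.hom_inv_id Q.total)
    exact (congrArg ((inv Q.total).app F).hom (Q.total_app_totalSymbol F Δ).symm).trans h
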